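/- Let $K_n$ be the complete graph on $n$ vertices, let $\beta_n\ge 0$ for each $n$, and let $\mathbf U=(U_e)_{e\in E(K_n)}$ be i.i.d. random variables uniform on $[0,1]$. Let $\mathsf{MST}_n$ be the spanning tree $T$ of $K_n$ minimizing $\sum_{e\in T}U_e$ (almost surely unique). Let $\mathsf{WST}_n^{\beta_n}$ be a random spanning tree of $K_n$ whose conditional law given $\mathbf U$ is $$\mathbb P\left(\mathsf{WST}_n^{\beta_n}=T\mid \mathbf U\right)=\frac{\exp\left(-\beta_n\sum_{e\in T}U_e\right)}{\sum_{T'}\exp\left(-\beta_n\sum_{e\in T'}U_e\right)}$$ for every spanning tree $T$ of $K_n$, where $T'$ runs over all spanning trees of $K_n$. Both trees are built from the same labels $\mathbf U$, and $\mathbb P$ denotes the resulting joint law. Then the following holds. a) If $n^2\log n=o(\beta_n)$ as $n\to\infty$, then $\lim_{n\to\infty}\mathbb P\left(\mathsf{WST}_n^{\beta_n}=\mathsf{MST}_n\right)=1$. b) If $\beta_n=o(n^2)$ as $n\to\infty$, then $\lim_{n\to\infty}\mathbb P\left(\mathsf{WST}_n^{\beta_n}\ne\mathsf{MST}_n\right)=1$.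 -/

import Mathlib

open MeasureTheory ProbabilityTheory Filter Asymptotics
open scoped ENNReal Topology

noncomputable section

namespace RandomSpanningTree

variable {V : Type*} [Fintype V]

open Classical in
/-- The spanning trees of `G`: subgraphs of `G` on the whole vertex set that are trees. -/
def spanningTrees (G : SimpleGraph V) : Finset (SimpleGraph V) :=
  {T | T ≤ G ∧ T.IsTree}

open Classical in
/-- The i.i.d. `Unif[0,1]` law of the family of labels `(U_e)`, `e` an edge of `G`. -/
def labelLaw (G : SimpleGraph V) : Measure (G.edgeSet → ℝ) :=
  Measure.pi fun _ => volume.restrict (Set.Icc (0 : ℝ) 1)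

open Classical in
/-- The sum of the labels over the edges of `T`. -/
def totalLabel (G : SimpleGraph V) (u : G.edgeSet → ℝ) (T : SimpleGraph V) : ℝ :=
  ∑ e : G.edgeSet with e.1 ∈ T.edgeSet, u e

/-- The minimum spanning tree of `G` for the labels `u`: the spanning tree with the smallest sum
of labels. If several spanning trees attain the minimum (an event of probability zero for
i.i.d. uniform labels), an arbitrary one of them is selected. -/
def MST (G : SimpleGraph V) (u : G.edgeSet → ℝ) : SimpleGraph V :=
  Classical.epsilon fun T =>
    T ∈ spanningTrees G ∧ ∀ T' ∈ spanningTrees G, totalLabel G u T ≤ totalLabel G u T'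

/-- The normalizing constant `Z_β(G | u)`. -/
def partitionFunction (G : SimpleGraph V) (β : ℝ) (u : G.edgeSet → ℝ) : ℝ :=
  ∑ T ∈ spanningTrees G, Real.exp (-β * totalLabel G u T)

/-- The conditional probability of the spanning tree `T` given the labels `u`. -/
def treeProb (G : SimpleGraph V) (β : ℝ) (u : G.edgeSet → ℝ) (T : SimpleGraph V) : ℝ :=
  Real.exp (-β * totalLabel G u T) / partitionFunction G β u

lemma measurable_totalLabel (G : SimpleGraph V) (T : SimpleGraph V) :
    Measurable fun u => totalLabel G u T := by
  unfold totalLabel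
  fun_prop

lemma measurable_treeProb (G : SimpleGraph V) (β : ℝ) (T : SimpleGraph V) :
    Measurable fun u => treeProb G β u T := by
  have h := measurable_totalLabel G
  unfold treeProb partitionFunction
  fun_prop

/-- The conditional law of the weighted spanning tree given the labels: the spanning tree `T` has
probability `treeProb G β u T` when the labels are `u`. -/
def wstKernel (G : SimpleGraph V) (β : ℝ) : Kernel (G.edgeSet → ℝ) (SimpleGraph V) where
  toFun u := ∑ T ∈ spanningTrees G, ENNReal.ofReal (treeProb G β u T) • Measure.dirac T
  measurable' := by
    refine Measure.measurable_of_measurable_coe _ fun s _ => ?_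
    simp only [Measure.coe_finsetSum, Finset.sum_apply, Measure.smul_apply, smul_eq_mul]
    have h := measurable_treeProb G β
    fun_prop

/-- For a connected graph, the conditional law of the weighted spanning tree is a probability
measure for all labels. -/
lemma isMarkovKernel_wstKernel {G : SimpleGraph V} (hG : G.Connected) (β : ℝ) :
    IsMarkovKernel (wstKernel G β) := by
  classical
  refine ⟨fun u => ⟨?_⟩⟩
  obtain ⟨T, hT, hT'⟩ := hG.exists_isTree_le
  have hZ : 0 < partitionFunction G β u :=
    Finset.sum_pos (fun _ _ => Real.exp_pos _) ⟨T, by simp [spanningTrees, hT, hT']⟩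
  change (∑ T ∈ spanningTrees G, ENNReal.ofReal (treeProb G β u T) • Measure.dirac T :
    Measure (SimpleGraph V)) Set.univ = 1
  simp only [Measure.coe_finsetSum, Finset.sum_apply, Measure.smul_apply, smul_eq_mul,
    measure_univ, mul_one]
  have hnn : ∀ T ∈ spanningTrees G, 0 ≤ treeProb G β u T :=
    fun T _ => div_nonneg (Real.exp_pos _).le hZ.le
  rw [← ENNReal.ofReal_sum_of_nonneg hnn]
  simp only [treeProb]
  rw [← Finset.sum_div]
  change ENNReal.ofReal (partitionFunction G β u / _) = 1
  rw [div_self hZ.ne', ENNReal.ofReal_one]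

instance isProbabilityMeasure_labelLaw (G : SimpleGraph V) :
    IsProbabilityMeasure (labelLaw G) := by
  have : IsProbabilityMeasure (volume.restrict (Set.Icc (0 : ℝ) 1)) := ⟨by simp⟩
  unfold labelLaw
  infer_instance

/-- The coupling of `WST^β(G)` and `MST(G)` through the same labels, as the joint law of the pair
`(U, WST^β(G))`: the labels `U` are i.i.d. `Unif[0,1]`, and given `U` the tree has the law of the
weighted spanning tree. The minimum spanning tree is the function `MST G U` of the labels. -/
def coupling (G : SimpleGraph V) (β : ℝ) : Measure ((G.edgeSet → ℝ) × SimpleGraph V) :=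
  labelLaw G ⊗ₘ wstKernel G β

lemma isProbabilityMeasure_coupling {G : SimpleGraph V} (hG : G.Connected) (β : ℝ) :
    IsProbabilityMeasure (coupling G β) := by
  have := isMarkovKernel_wstKernel hG β
  unfold coupling
  infer_instance

end RandomSpanningTree

end

/-! Everything rests on comparing a spanning tree with the trees one edge exchange away. For a tree
`T` and an edge `e` outside it, `bottleneck G T e u` is the largest label on the path of `T` joining
the ends of `e`. Almost surely the MST is the unique `T` for which every outside edge exceeds its
bottleneck (`isStrictMin_MST`, `IsStrictMin.eq`). The bottlenecks of `T` involve only labels of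
edges of `T`. Hence, given that `T` is the MST and given the labels on `T`, the outside labels are
independent and uniform above their bottlenecks.

Large `β`: if every outside edge clears its bottleneck by `δ`, symmetric exchange sends each tree
other than the MST to a tree at least `exp (β * δ)` times heavier, together with the two exchanged
edges. This encoding is injective, so the other trees carry total probability at most `|E|^2 * exp
(-β * δ)` (`one_le_treeProb_add`). A given edge violates the gap with probability at most `δ`
(`labelLaw_nearTie_le`). With `δ = ε / n^2` both errors are small once `β` dominates `n^2 * log n`.

Small `β`: each outside edge yields a competitor of relative weight `exp (-β * (u e - bottleneck))`.
With `S` the sum of these weights, the MST has conditional probability at most `1 / (1 + S)`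
(`treeProb_le_inv`). By the independence above, the expectation of `exp (-S)` given the MST is at
most `(1 - c / (1 + β)) ^ m`, with `m` of order `n^2` outside edges. So `S` is at least of order
`n^2 / (1 + β)` with high probability, and this diverges. -/

namespace RandomSpanningTree

/-! ### Edge exchanges between trees -/

section Exchange

variable {V : Type*}

/-- The graph obtained from `T` by deleting the edge `f` and adding the edge `e`. -/
def swapEdge (T : SimpleGraph V) (f e : Sym2 V) : SimpleGraph V :=
  T.deleteEdges {f} ⊔ SimpleGraph.fromEdgeSet {e}

lemma edgeSet_swapEdge (T : SimpleGraph V) (f : Sym2 V) {e : Sym2 V} (he : ¬ e.IsDiag) :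
    (swapEdge T f e).edgeSet = insert e (T.edgeSet \ {f}) := by
  ext a
  simp only [swapEdge, SimpleGraph.edgeSet_sup, SimpleGraph.edgeSet_deleteEdges,
    SimpleGraph.edgeSet_fromEdgeSet, Set.mem_union, Set.mem_insert_iff, Set.mem_sdiff,
    Set.mem_singleton_iff, Sym2.mem_diagSet]
  constructor
  · rintro (h | h)
    · exact Or.inr h
    · exact Or.inl h.1
  · rintro (h | h)
    · exact Or.inr ⟨h, h ▸ he⟩
    · exact Or.inl h

lemma swapEdge_swapEdge {T : SimpleGraph V} {f e : Sym2 V} (hf : f ∈ T.edgeSet)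
    (he : e ∉ T.edgeSet) (hed : ¬ e.IsDiag) : swapEdge (swapEdge T f e) e f = T := by
  have hfd : ¬ f.IsDiag := T.not_isDiag_of_mem_edgeSet hf
  rw [← SimpleGraph.edgeSet_inj, edgeSet_swapEdge _ _ hfd, edgeSet_swapEdge _ _ hed]
  ext a
  simp only [Set.mem_insert_iff, Set.mem_sdiff, Set.mem_singleton_iff]
  grind

/-- An acyclic graph extends to a spanning tree of the complete graph, and the edge count leaves no
room for a proper extension. -/
lemma isTree_of_isAcyclic_of_card [Finite V] [Nonempty V] {H : SimpleGraph V} (hH : H.IsAcyclic)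
    (hc : H.edgeSet.ncard + 1 = Nat.card V) : H.IsTree := by
  obtain ⟨F, hHF, -, hF⟩ :=
    SimpleGraph.connected_top.exists_isTree_le_of_le_of_isAcyclic (le_top : H ≤ ⊤) hH
  have hFc := (SimpleGraph.isTree_iff_connected_and_card.1 hF).2
  have : H.edgeSet = F.edgeSet := by
    refine Set.eq_of_subset_of_ncard_le (SimpleGraph.edgeSet_mono hHF) ?_ (Set.toFinite _)
    rw [Nat.card_coe_set_eq] at hFc
    omega
  rwa [SimpleGraph.edgeSet_inj.1 this]

lemma isTree_swapEdge [Finite V] {T : SimpleGraph V} (hT : T.IsTree) {f : Sym2 V}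
    (hf : f ∈ T.edgeSet) {x y : V} (hxy : x ≠ y) (he : s(x, y) ∉ T.edgeSet)
    (hr : ¬ (T.deleteEdges {f}).Reachable x y) : (swapEdge T f s(x, y)).IsTree := by
  have := hT.connected.nonempty
  refine isTree_of_isAcyclic_of_card ?_ ?_
  · exact (hT.isAcyclic.anti (SimpleGraph.deleteEdges_le _)).sup_edge_of_not_reachable hr
  · rw [edgeSet_swapEdge _ _ (by simpa using hxy), Set.ncard_insert_of_notMem (fun h => he h.1),
      Set.ncard_sdiff_singleton_add_one hf]
    exact (SimpleGraph.isTree_iff_connected_and_card.1 hT).2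

/-- The symmetric exchange property of trees on the same vertex set. -/
lemma exists_isTree_swapEdge [Finite V] {T T' : SimpleGraph V} (hT : T.IsTree) (hT' : T'.IsTree)
    {e : Sym2 V} (he : e ∈ T.edgeSet) (he' : e ∉ T'.edgeSet) :
    ∃ f ∈ T'.edgeSet, f ∉ T.edgeSet ∧ (swapEdge T e f).IsTree ∧ (swapEdge T' f e).IsTree := by
  induction e using Sym2.ind with | _ x y
  have hxy : ¬ (T.deleteEdges {s(x, y)}).Reachable x y := by
    have := SimpleGraph.isAcyclic_iff_forall_isBridge.1 hT.isAcyclic he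
    rwa [SimpleGraph.isBridge_iff] at this
  have hne : x ≠ y := T.ne_of_adj he
  obtain ⟨p, hp⟩ := (hT'.connected.preconnected x y).exists_isPath
  -- Deleting `e` splits `T` in two. The path of `T'` between the ends of `e` must leave the side of
  -- `x`; the edge where it does so is the required `f`.
  obtain ⟨d, hd, hd1, hd2⟩ := p.exists_boundary_dart
    {v | (T.deleteEdges {s(x, y)}).Reachable x v} (SimpleGraph.Reachable.refl _) hxy
  have hdp : d.edge ∈ p.edges := List.mem_map_of_mem hd
  have hdT' : d.edge ∈ T'.edgeSet := d.edge_mem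
  have hdT : d.edge ∉ T.edgeSet := by
    intro h
    refine hd2 (SimpleGraph.Reachable.trans hd1 (SimpleGraph.Adj.reachable ?_))
    rw [SimpleGraph.deleteEdges_adj]
    refine ⟨h, fun h' => he' ?_⟩
    rw [Set.mem_singleton_iff] at h'
    rw [← h']
    exact d.adj
  refine ⟨d.edge, hdT', hdT, ?_, ?_⟩
  · exact isTree_swapEdge hT he d.adj.ne hdT fun h => hd2 (SimpleGraph.Reachable.trans hd1 h)
  -- Paths in `T'` are unique and `p` uses `f`, so no path from `x` to `y` survives the deletion of
  -- `f`.
  · refine isTree_swapEdge hT' hdT' hne he' fun h => ?_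
    obtain ⟨q, hq⟩ := h.exists_isPath
    have hq' := hq.mapLe (SimpleGraph.deleteEdges_le (G := T') {d.edge})
    have heq := congrArg Subtype.val
      ((hT'.isAcyclic.subsingleton_path x y).elim ⟨p, hp⟩ ⟨_, hq'⟩)
    dsimp only at heq
    rw [heq, SimpleGraph.Walk.edges_mapLe_eq_edges] at hdp
    have := q.edges_subset_edgeSet hdp
    simp at this

lemma exists_mem_edgeSet_of_ne [Finite V] {T T' : SimpleGraph V} (hT : T.IsTree) (hT' : T'.IsTree)
    (h : T ≠ T') : ∃ e ∈ T.edgeSet, e ∉ T'.edgeSet := by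
  by_contra! hc
  have hle : T ≤ T' := SimpleGraph.edgeSet_subset_edgeSet.1 hc
  exact h (le_antisymm hle ((SimpleGraph.isTree_iff_minimal_connected.1 hT').2 hT.connected hle))

/-- Every edge outside a spanning tree can replace some edge of the tree. -/
lemma exists_isTree_swapEdge_of_notMem [Finite V] {T : SimpleGraph V} (hT : T.IsTree)
    {e : Sym2 V} (he : e ∉ T.edgeSet) (hed : ¬ e.IsDiag) :
    ∃ f ∈ T.edgeSet, (swapEdge T f e).IsTree := by
  have := hT.connected.nonempty
  induction e using Sym2.ind with | _ x y
  have hac : (SimpleGraph.edge x y).IsAcyclic := by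
    have hb : (⊥ : SimpleGraph V).IsAcyclic := SimpleGraph.isAcyclic_bot
    have := hb.sup_edge_of_not_reachable (u := x) (v := y)
      (by simpa [SimpleGraph.reachable_bot] using hed)
    simpa using this
  -- Any tree `F` through `e` serves as partner: symmetric exchange of `e` between `F` and `T`
  -- yields the edge of `T` to remove.
  obtain ⟨F, hF1, -, hF⟩ :=
    SimpleGraph.connected_top.exists_isTree_le_of_le_of_isAcyclic (le_top : _ ≤ ⊤) hac
  have heF : s(x, y) ∈ F.edgeSet := SimpleGraph.edgeSet_mono hF1 (by simpa using hed)
  obtain ⟨f, hf, -, -, h⟩ := exists_isTree_swapEdge hF hT heF he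
  exact ⟨f, hf, h⟩

end Exchange

/-! ### Bottlenecks and the local characterization of the MST -/

section Bottleneck

variable {V : Type*} [Fintype V] {G T T' : SimpleGraph V}

lemma mem_spanningTrees : T ∈ spanningTrees G ↔ T ≤ G ∧ T.IsTree := by
  simp [spanningTrees]

open Classical in
/-- The edges of `T` that can be exchanged for `e`. If `T` is a spanning tree and `e` is not an
edge of `T`, these are the edges of the path in `T` between the endpoints of `e`. -/
noncomputable def replaceable (G T : SimpleGraph V) (e : G.edgeSet) : Finset G.edgeSet :=
  {f | f.1 ∈ T.edgeSet ∧ (swapEdge T f e).IsTree}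

lemma mem_replaceable {e f : G.edgeSet} :
    f ∈ replaceable G T e ↔ f.1 ∈ T.edgeSet ∧ (swapEdge T f e).IsTree := by
  simp [replaceable]

/-- The largest label of an edge of `T` that can be exchanged for `e`. -/
noncomputable def bottleneck (G T : SimpleGraph V) (e : G.edgeSet) (u : G.edgeSet → ℝ) : NNReal :=
  (replaceable G T e).sup fun f => (u f).toNNReal

/-- Every edge outside `T` has a larger label than the edges of `T` it can be exchanged for. -/
def IsStrictMin (G T : SimpleGraph V) (u : G.edgeSet → ℝ) : Prop :=
  ∀ e : G.edgeSet, e.1 ∉ T.edgeSet → (bottleneck G T e u : ℝ) < u e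

lemma measurable_bottleneck (G T : SimpleGraph V) (e : G.edgeSet) :
    Measurable fun u => bottleneck G T e u := by
  classical
  unfold bottleneck
  induction replaceable G T e using Finset.induction_on with
  | empty => simp
  | insert a s _ ih =>
    simp only [Finset.sup_insert]
    exact Measurable.sup (by fun_prop) ih

lemma measurableSet_isStrictMin (G T : SimpleGraph V) : MeasurableSet {u | IsStrictMin G T u} := by
  have := measurable_bottleneck G T
  simp only [IsStrictMin, Set.ofPred_forall]
  refine .iInter fun e => .iInter fun _ => measurableSet_lt ?_ ?_ <;> fun_prop

/-- Only labels on `T` enter a bottleneck. This is the source of independence between outside edges.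
-/
lemma bottleneck_update [DecidableEq G.edgeSet] (u : G.edgeSet → ℝ) {e : G.edgeSet}
    (he : e.1 ∉ T.edgeSet) (e' : G.edgeSet) (s : ℝ) :
    bottleneck G T e' (Function.update u e s) = bottleneck G T e' u := by
  refine Finset.sup_congr rfl fun f hf => ?_
  rw [Function.update_of_ne]
  rintro rfl
  exact he (mem_replaceable.1 hf).1

lemma le_bottleneck {e f : G.edgeSet} (hf : f ∈ replaceable G T e) (u : G.edgeSet → ℝ) :
    u f ≤ bottleneck G T e u :=
  (Real.le_coe_toNNReal _).trans <| NNReal.coe_le_coe.2 <|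
    Finset.le_sup (f := fun f => (u f).toNNReal) hf

/-- The supremum is over a nonempty set, hence attained. Positivity of the labels makes the
truncation in `toNNReal` harmless. -/
lemma exists_bottleneck_eq (hT : T.IsTree) {e : G.edgeSet} (he : e.1 ∉ T.edgeSet) (hTG : T ≤ G)
    {u : G.edgeSet → ℝ} (hu : ∀ f, 0 < u f) :
    ∃ f ∈ replaceable G T e, (bottleneck G T e u : ℝ) = u f := by
  obtain ⟨f, hf, hfT⟩ :=
    exists_isTree_swapEdge_of_notMem hT he (G.not_isDiag_of_mem_edgeSet e.2)
  obtain ⟨f', hf', h⟩ := Finset.exists_mem_eq_sup (replaceable G T e)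
    ⟨⟨f, SimpleGraph.edgeSet_mono hTG hf⟩, mem_replaceable.2 ⟨hf, hfT⟩⟩ fun f => (u f).toNNReal
  exact ⟨f', hf', by rw [bottleneck, h, Real.coe_toNNReal _ (hu f').le]⟩

/-- A symmetric exchange of `e` in `T` with `f` in `T'` would force both `u e < u f` and `u f < u
e`. -/
lemma IsStrictMin.eq {u : G.edgeSet → ℝ} (h : IsStrictMin G T u) (h' : IsStrictMin G T' u)
    (hT : T ∈ spanningTrees G) (hT' : T' ∈ spanningTrees G) : T = T' := by
  rw [mem_spanningTrees] at hT hT'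
  by_contra hne
  obtain ⟨e, he, he'⟩ := exists_mem_edgeSet_of_ne hT.2 hT'.2 hne
  obtain ⟨f, hf', hf, h1, h2⟩ := exists_isTree_swapEdge hT.2 hT'.2 he he'
  let e₀ : G.edgeSet := ⟨e, SimpleGraph.edgeSet_mono hT.1 he⟩
  let f₀ : G.edgeSet := ⟨f, SimpleGraph.edgeSet_mono hT'.1 hf'⟩
  have a1 := (le_bottleneck (T := T) (e := f₀) (f := e₀) (mem_replaceable.2 ⟨he, h1⟩) u).trans_lt
    (h f₀ hf)
  have a2 := (le_bottleneck (T := T') (e := e₀) (f := f₀) (mem_replaceable.2 ⟨hf', h2⟩) u).trans_lt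
    (h' e₀ he')
  exact lt_asymm a1 a2

lemma totalLabel_swapEdge {e f : G.edgeSet} (he : e.1 ∉ T.edgeSet) (hf : f.1 ∈ T.edgeSet)
    (u : G.edgeSet → ℝ) :
    totalLabel G u (swapEdge T f e) = totalLabel G u T - u f + u e := by
  classical
  have hed := G.not_isDiag_of_mem_edgeSet e.2
  have key : (Finset.univ.filter fun a : G.edgeSet => a.1 ∈ (swapEdge T f e).edgeSet)
      = insert e ((Finset.univ.filter fun a : G.edgeSet => a.1 ∈ T.edgeSet).erase f) := by
    ext a
    simp only [edgeSet_swapEdge T f.1 hed, Finset.mem_filter, Finset.mem_univ, true_and,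
      Set.mem_insert_iff, Set.mem_sdiff, Set.mem_singleton_iff, Finset.mem_insert,
      Finset.mem_erase, Subtype.ext_iff, ne_eq]
    tauto
  have h1 : totalLabel G u (swapEdge T f e) = ∑ a ∈
      insert e ((Finset.univ.filter fun a : G.edgeSet => a.1 ∈ T.edgeSet).erase f), u a := by
    rw [← key]
    unfold totalLabel
    congr!
  have h2 : totalLabel G u T
      = ∑ a ∈ (Finset.univ.filter fun a : G.edgeSet => a.1 ∈ T.edgeSet), u a := by
    unfold totalLabel
    congr!
  rw [h1, h2, Finset.sum_insert (by simp [he]),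
    ← Finset.sum_erase_add (Finset.univ.filter fun a : G.edgeSet => a.1 ∈ T.edgeSet) u
      (a := f) (by simpa using hf)]
  ring

lemma swapEdge_mem_spanningTrees (hT : T ≤ G) {e : G.edgeSet} {f : Sym2 V}
    (h : (swapEdge T f e).IsTree) : swapEdge T f e ∈ spanningTrees G := by
  refine mem_spanningTrees.2 ⟨?_, h⟩
  rw [← SimpleGraph.edgeSet_subset_edgeSet,
    edgeSet_swapEdge _ _ (G.not_isDiag_of_mem_edgeSet e.2)]
  exact Set.insert_subset e.2 (Set.sdiff_subset.trans (SimpleGraph.edgeSet_mono hT))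

lemma spanningTrees_nonempty (hG : G.Connected) : (spanningTrees G).Nonempty := by
  obtain ⟨T, hT, hT'⟩ := hG.exists_isTree_le
  exact ⟨T, mem_spanningTrees.2 ⟨hT, hT'⟩⟩

lemma MST_spec (hG : G.Connected) (u : G.edgeSet → ℝ) :
    MST G u ∈ spanningTrees G ∧
      ∀ T' ∈ spanningTrees G, totalLabel G u (MST G u) ≤ totalLabel G u T' := by
  obtain ⟨T, hT, h⟩ := (spanningTrees G).exists_min_image (totalLabel G u)
    (spanningTrees_nonempty hG)
  exact Classical.epsilon_spec (p := fun T => T ∈ spanningTrees G ∧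
    ∀ T' ∈ spanningTrees G, totalLabel G u T ≤ totalLabel G u T') ⟨T, hT, h⟩

/-- Exchanging `e` for its bottleneck edge cannot lower the total label, and injectivity of `u`
excludes a tie. -/
lemma isStrictMin_MST (hG : G.Connected) {u : G.edgeSet → ℝ} (hu : ∀ e, 0 < u e)
    (hinj : Function.Injective u) : IsStrictMin G (MST G u) u := by
  intro e he
  obtain ⟨hM, hmin⟩ := MST_spec hG u
  rw [mem_spanningTrees] at hM
  obtain ⟨f, hf, h⟩ := exists_bottleneck_eq hM.2 he hM.1 hu
  rw [h]
  rw [mem_replaceable] at hf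
  have := hmin _ (swapEdge_mem_spanningTrees hM.1 hf.2)
  rw [totalLabel_swapEdge he hf.1] at this
  refine lt_of_le_of_ne (by linarith) fun h' => he ?_
  rw [← hinj h']
  exact hf.1

end Bottleneck

/-! ### Almost sure properties of the labels, and measurability -/

section Labels

variable {V : Type*} [Fintype V] {G : SimpleGraph V}

/-- A set has small product measure if all its sections along one coordinate are small. -/
lemma measure_pi_le_of_update {ι : Type*} [Fintype ι] [DecidableEq ι] {X : ι → Type*}
    [∀ i, MeasurableSpace (X i)] (μ : ∀ i, Measure (X i)) [∀ i, IsProbabilityMeasure (μ i)]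
    {s : Set (∀ i, X i)} (hs : MeasurableSet s) (i : ι) (c : ℝ≥0∞)
    (h : ∀ u, μ i {x | Function.update u i x ∈ s} ≤ c) : Measure.pi μ s ≤ c := by
  have := lintegral_le_of_lmarginal_le (μ := μ) {i} (f := s.indicator 1) (g := fun _ => c)
    (measurable_one.indicator hs) measurable_const (fun u => ?_)
  · simpa [lintegral_indicator_one hs] using this
  · rw [lmarginal_singleton, lmarginal_singleton]
    have hm : MeasurableSet {x | Function.update u i x ∈ s} := measurable_update u hs
    have heq : (fun x => s.indicator (1 : (∀ i, X i) → ℝ≥0∞) (Function.update u i x))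
        = {x | Function.update u i x ∈ s}.indicator 1 := by
      ext x; rfl
    simp only [heq, lintegral_indicator_one hm, lintegral_const, measure_univ, mul_one]
    exact h u

instance isProbabilityMeasure_restrict_Icc :
    IsProbabilityMeasure (volume.restrict (Set.Icc (0 : ℝ) 1)) := ⟨by simp⟩

lemma labelLaw_le_of_update [DecidableEq G.edgeSet] {s : Set (G.edgeSet → ℝ)}
    (hs : MeasurableSet s) (e : G.edgeSet) (c : ℝ≥0∞)
    (h : ∀ u, volume {x | Function.update u e x ∈ s} ≤ c) : labelLaw G s ≤ c := by
  classical
  unfold labelLaw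
  exact measure_pi_le_of_update _ hs e c fun u => (Measure.restrict_apply_le _ _).trans (h u)

lemma ae_labelLaw_pos (G : SimpleGraph V) : ∀ᵐ u ∂labelLaw G, ∀ e, 0 < u e := by
  classical
  refine ae_all_iff.2 fun e => ?_
  rw [ae_iff]
  have hs : MeasurableSet {u : G.edgeSet → ℝ | ¬ 0 < u e} := by
    simp only [not_lt]
    exact measurableSet_le (by fun_prop) (by fun_prop)
  refine le_antisymm ?_ zero_le
  unfold labelLaw
  refine measure_pi_le_of_update _ hs e 0 fun u => ?_
  have : {x : ℝ | Function.update u e x ∈ {u : G.edgeSet → ℝ | ¬ 0 < u e}} = Set.Iic 0 := by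
    ext x; simp
  rw [this, Measure.restrict_apply measurableSet_Iic]
  refine (measure_mono (t := {0}) ?_).trans (by simp)
  rintro x ⟨h1, h2, -⟩
  exact le_antisymm h1 h2

lemma ae_labelLaw_injective (G : SimpleGraph V) :
    ∀ᵐ u ∂labelLaw G, Function.Injective u := by
  classical
  have : ∀ᵐ u ∂labelLaw G, ∀ e f : G.edgeSet, e ≠ f → u e ≠ u f := by
    refine ae_all_iff.2 fun e => ae_all_iff.2 fun f => ?_
    by_cases hef : e = f
    · simp [hef]
    rw [ae_iff]
    refine le_antisymm ?_ zero_le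
    have hset : {u : G.edgeSet → ℝ | ¬ (e ≠ f → u e ≠ u f)} = {u | u e = u f} := by
      ext u; simp [hef]
    rw [hset]
    refine labelLaw_le_of_update (measurableSet_eq_fun (by fun_prop) (by fun_prop)) e 0
      fun u => ?_
    refine (measure_mono (t := {u f}) ?_).trans (by simp)
    intro x hx
    simpa [Function.update_of_ne (Ne.symm hef)] using hx
  filter_upwards [this] with u hu e f h
  by_contra hef
  exact hu e f hef h

lemma ae_labelLaw_isStrictMin_MST (hG : G.Connected) :
    ∀ᵐ u ∂labelLaw G, IsStrictMin G (MST G u) u := by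
  filter_upwards [ae_labelLaw_pos G, ae_labelLaw_injective G] with u hu hinj
  exact isStrictMin_MST hG hu hinj

instance measurableSingletonClass_simpleGraph : MeasurableSingletonClass (SimpleGraph V) := by
  refine ⟨fun T => ⟨{T.Adj}, measurableSet_singleton _, ?_⟩⟩
  ext T'
  exact SimpleGraph.adj_inj

/-- The choice made by `epsilon` depends on the labels only through the order relation they induce
on trees, which takes finitely many values. -/
lemma measurableSet_MST_eq (T : SimpleGraph V) : MeasurableSet {u | MST G u = T} := by
  let F : (G.edgeSet → ℝ) → Set (SimpleGraph V × SimpleGraph V) :=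
    fun u => {p | totalLabel G u p.1 ≤ totalLabel G u p.2}
  let g : Set (SimpleGraph V × SimpleGraph V) → SimpleGraph V := fun R =>
    Classical.epsilon fun T => T ∈ spanningTrees G ∧ ∀ T' ∈ spanningTrees G, (T, T') ∈ R
  have hF : Measurable F := by
    refine measurable_set_iff.2 fun p => ?_
    exact measurableSet_setOfPred.1
      (measurableSet_le (measurable_totalLabel G p.1) (measurable_totalLabel G p.2))
  exact hF (Set.toFinite {R | g R = T}).measurableSet

lemma measurableSet_eq_MST :
    MeasurableSet {ω : (G.edgeSet → ℝ) × SimpleGraph V | ω.2 = MST G ω.1} := by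
  have : {ω : (G.edgeSet → ℝ) × SimpleGraph V | ω.2 = MST G ω.1}
      = ⋃ T, {u | MST G u = T} ×ˢ {T} := by
    ext ω; simp [eq_comm]
  rw [this]
  exact .iUnion fun T => (measurableSet_MST_eq T).prod (measurableSet_singleton T)

lemma coupling_apply_eq_MST (hG : G.Connected) (β : ℝ) :
    coupling G β {ω | ω.2 = MST G ω.1}
      = ∫⁻ u, ENNReal.ofReal (treeProb G β u (MST G u)) ∂labelLaw G := by
  have := isMarkovKernel_wstKernel hG β
  rw [coupling, Measure.compProd_apply]
  · refine lintegral_congr fun u => ?_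
    change (∑ T ∈ spanningTrees G, ENNReal.ofReal (treeProb G β u T) • Measure.dirac T :
      Measure (SimpleGraph V)) {T | T = MST G u} = _
    simp only [Measure.coe_finsetSum, Finset.sum_apply, Measure.smul_apply, smul_eq_mul,
      Set.ofPred_eq_eq_singleton, Measure.dirac_apply]
    rw [Finset.sum_eq_single_of_mem _ (MST_spec hG u).1]
    · simp
    · intro T _ hT; simp [hT]
  · exact measurableSet_eq_MST

end Labels

/-! ### Large `β`: the MST dominates -/

section LargeBeta

variable {V : Type*} [Fintype V] {G M : SimpleGraph V}

lemma partitionFunction_pos (hG : G.Connected) (β : ℝ) (u : G.edgeSet → ℝ) :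
    0 < partitionFunction G β u :=
  Finset.sum_pos (fun _ _ => Real.exp_pos _) (spanningTrees_nonempty hG)

/-- If every edge outside `M` exceeds the edges of `M` it can be exchanged for by at least `δ`, then
the weighted spanning tree equals `M` with high conditional probability. -/
lemma one_le_treeProb_add (hM : M ∈ spanningTrees G) {β δ : ℝ} (hβ : 0 ≤ β)
    {u : G.edgeSet → ℝ}
    (hgap : ∀ e : G.edgeSet, e.1 ∉ M.edgeSet → ∀ f ∈ replaceable G M e, u f + δ ≤ u e) :
    1 ≤ treeProb G β u M + (Nat.card G.edgeSet : ℝ) ^ 2 * Real.exp (-(β * δ)) := by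
  classical
  have hM' := mem_spanningTrees.1 hM
  have hG : G.Connected := hM'.2.connected.mono hM'.1
  have hZ := partitionFunction_pos hG β u
  set w : SimpleGraph V → ℝ := fun T => Real.exp (-β * totalLabel G u T) with hw
  -- Move `T` towards `M` by one exchange. Remembering the two edges makes the move reversible,
  -- hence injective.
  have hex : ∀ T ∈ (spanningTrees G).erase M, ∃ p : SimpleGraph V × G.edgeSet × G.edgeSet,
      p.1 ∈ spanningTrees G ∧ swapEdge p.1 p.2.2 p.2.1 = T ∧
        w T ≤ Real.exp (-(β * δ)) * w p.1 := by
    intro T hT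
    rw [Finset.mem_erase, mem_spanningTrees] at hT
    obtain ⟨hne, hTG, hT⟩ := hT
    obtain ⟨e, he, he'⟩ := exists_mem_edgeSet_of_ne hT hM'.2 hne
    obtain ⟨f, hf', hf, h1, h2⟩ := exists_isTree_swapEdge hT hM'.2 he he'
    let e₀ : G.edgeSet := ⟨e, SimpleGraph.edgeSet_mono hTG he⟩
    let f₀ : G.edgeSet := ⟨f, SimpleGraph.edgeSet_mono hM'.1 hf'⟩
    refine ⟨(swapEdge T e f, e₀, f₀), swapEdge_mem_spanningTrees (e := f₀) hTG h1,
      swapEdge_swapEdge he hf (M.not_isDiag_of_mem_edgeSet hf'), ?_⟩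
    have hlab : totalLabel G u (swapEdge T e f) = totalLabel G u T - u e₀ + u f₀ :=
      totalLabel_swapEdge (e := f₀) (f := e₀) hf he u
    have hg := hgap e₀ he' f₀ (mem_replaceable.2 ⟨hf', h2⟩)
    simp only [hw]
    rw [← Real.exp_add, Real.exp_le_exp, hlab]
    nlinarith
  have hsum : ∑ T ∈ (spanningTrees G).erase M, w T
      ≤ (Nat.card G.edgeSet : ℝ) ^ 2 * Real.exp (-(β * δ)) * partitionFunction G β u := by
    rcases ((spanningTrees G).erase M).eq_empty_or_nonempty with hempty | ⟨T₀, hT₀⟩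
    · rw [hempty, Finset.sum_empty]
      positivity
    have : Nonempty (SimpleGraph V × G.edgeSet × G.edgeSet) := ⟨(hex T₀ hT₀).choose⟩
    choose! Φ hΦ1 hΦ2 hΦ3 using hex
    have hinj : Set.InjOn Φ (((spanningTrees G).erase M : Finset _) : Set (SimpleGraph V)) := by
      intro T hT T' hT' h
      rw [← hΦ2 T hT, ← hΦ2 T' hT', h]
    calc ∑ T ∈ (spanningTrees G).erase M, w T
        ≤ ∑ T ∈ (spanningTrees G).erase M, Real.exp (-(β * δ)) * w (Φ T).1 :=
          Finset.sum_le_sum fun T hT => hΦ3 T hT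
      _ = ∑ p ∈ ((spanningTrees G).erase M).image Φ, Real.exp (-(β * δ)) * w p.1 := by
          rw [Finset.sum_image hinj]
      _ ≤ ∑ p ∈ spanningTrees G ×ˢ (Finset.univ : Finset (G.edgeSet × G.edgeSet)),
            Real.exp (-(β * δ)) * w p.1 := by
          -- Enlarging the image to all triples counts each spanning tree `|E|^2` times.
          refine Finset.sum_le_sum_of_subset_of_nonneg ?_ fun _ _ _ => by positivity
          intro p hp
          obtain ⟨T, hT, rfl⟩ := Finset.mem_image.1 hp
          exact Finset.mem_product.2 ⟨hΦ1 T hT, Finset.mem_univ _⟩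
      _ = _ := by
          rw [Finset.sum_product]
          simp only [Finset.sum_const, Finset.card_univ, Fintype.card_prod, nsmul_eq_mul,
            Nat.cast_mul, Nat.card_eq_fintype_card, partitionFunction, hw, Finset.mul_sum]
          refine Finset.sum_congr rfl fun T _ => ?_
          ring
  have hsplit : partitionFunction G β u = w M + ∑ T ∈ (spanningTrees G).erase M, w T :=
    (Finset.add_sum_erase _ _ hM).symm
  have : treeProb G β u M * partitionFunction G β u = w M := div_mul_cancel₀ _ hZ.ne'
  refine le_of_mul_le_mul_right ?_ hZ
  rw [add_mul, this, one_mul]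
  linarith

/-- The labels for which the edge `e` is outside a strictly minimal tree but within `δ` of
entering it. -/
def nearTie (G : SimpleGraph V) (δ : ℝ) (e : G.edgeSet) : Set (G.edgeSet → ℝ) :=
  ⋃ T ∈ spanningTrees G, ⋃ _ : e.1 ∉ T.edgeSet,
    {u | IsStrictMin G T u} ∩ {u | u e < bottleneck G T e u + δ}

lemma measurableSet_nearTie (G : SimpleGraph V) (δ : ℝ) (e : G.edgeSet) :
    MeasurableSet (nearTie G δ e) := by
  have := measurable_bottleneck G
  refine Finset.measurableSet_biUnion _ fun T _ => .iUnion fun _ =>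
    (measurableSet_isStrictMin G T).inter (measurableSet_lt ?_ ?_) <;> fun_prop

lemma isStrictMin_update_of_lt {T : SimpleGraph V} [DecidableEq G.edgeSet] {u : G.edgeSet → ℝ}
    {e : G.edgeSet} (he : e.1 ∉ T.edgeSet) {s t : ℝ} (hst : s ≤ t)
    (h : IsStrictMin G T (Function.update u e s)) : IsStrictMin G T (Function.update u e t) := by
  intro e' he'
  have := h e' he'
  rw [bottleneck_update u he] at this ⊢
  by_cases hee : e' = e
  · subst hee
    simp only [Function.update_self] at this ⊢
    exact this.trans_le hst
  · simpa only [Function.update_of_ne hee] using this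

/-- Fix all labels but that of `e`. Raising `u e` keeps a strictly minimal tree that avoids `e`, so
by uniqueness a single tree, with a single bottleneck `b`, serves all admissible values of `u e`.
These values lie between `b` and `b + δ`. -/
lemma labelLaw_nearTie_le (G : SimpleGraph V) (δ : ℝ) (e : G.edgeSet) :
    labelLaw G (nearTie G δ e) ≤ ENNReal.ofReal δ := by
  classical
  refine labelLaw_le_of_update (measurableSet_nearTie G δ e) e _ fun u => ?_
  refine (Real.volume_le_diam _).trans ?_
  have key : ∀ s t : ℝ, Function.update u e s ∈ nearTie G δ e →
      Function.update u e t ∈ nearTie G δ e → s ≤ t → t - s ≤ δ := by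
    intro s t hs ht hst
    simp only [nearTie, Set.mem_iUnion, Set.mem_inter_iff, Set.mem_ofPred_eq] at hs ht
    obtain ⟨T, hT, heT, hTs, -⟩ := hs
    obtain ⟨T', hT', heT', hTt, hlt⟩ := ht
    obtain rfl : T = T' := (isStrictMin_update_of_lt heT hst hTs).eq hTt hT hT'
    have h1 := hTs e heT
    rw [bottleneck_update u heT, Function.update_self] at h1 hlt
    linarith
  refine Metric.ediam_le fun s hs t ht => ?_
  rw [edist_dist, Real.dist_eq]
  refine ENNReal.ofReal_le_ofReal ?_
  rcases le_total s t with h | h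
  · rw [abs_of_nonpos (by linarith)]
    linarith [key s t hs ht h]
  · rw [abs_of_nonneg (by linarith)]
    exact key t s ht hs h

lemma one_le_lintegral_treeProb_add (hG : G.Connected) {β : ℝ} (hβ : 0 ≤ β) (δ : ℝ) :
    1 ≤ ∫⁻ u, ENNReal.ofReal (treeProb G β u (MST G u)) ∂labelLaw G
      + (Nat.card G.edgeSet * ENNReal.ofReal δ
        + ENNReal.ofReal ((Nat.card G.edgeSet : ℝ) ^ 2 * Real.exp (-(β * δ)))) := by
  classical
  set η := (Nat.card G.edgeSet : ℝ) ^ 2 * Real.exp (-(β * δ)) with hη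
  set B : Set (G.edgeSet → ℝ) := ⋃ e, nearTie G δ e with hB
  have hBm : MeasurableSet B := .iUnion fun e => measurableSet_nearTie G δ e
  have hBle : labelLaw G B ≤ Nat.card G.edgeSet * ENNReal.ofReal δ := by
    refine (measure_iUnion_fintype_le _ _).trans ?_
    refine (Finset.sum_le_sum fun e _ => labelLaw_nearTie_le G δ e).trans ?_
    simp [Nat.card_eq_fintype_card]
  have hpt : ∀ᵐ u ∂labelLaw G, (1 : ℝ≥0∞) ≤ ENNReal.ofReal (treeProb G β u (MST G u))
      + (B.indicator 1 u + ENNReal.ofReal η) := by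
    filter_upwards [ae_labelLaw_isStrictMin_MST hG] with u hu
    by_cases huB : u ∈ B
    · rw [Set.indicator_of_mem huB]
      exact le_add_left (le_add_right le_rfl)
    · rw [Set.indicator_of_notMem huB, zero_add, ← ENNReal.ofReal_add (by
        unfold treeProb; have := partitionFunction_pos hG β u; positivity) (by positivity)]
      rw [← ENNReal.ofReal_one]
      refine ENNReal.ofReal_le_ofReal (one_le_treeProb_add (MST_spec hG u).1 hβ ?_)
      intro e he f hf
      by_contra! hlt
      refine huB (Set.mem_iUnion.2 ⟨e, ?_⟩)
      simp only [nearTie, Set.mem_iUnion, Set.mem_inter_iff, Set.mem_ofPred_eq]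
      refine ⟨MST G u, (MST_spec hG u).1, he, hu, ?_⟩
      linarith [le_bottleneck hf u]
  calc (1 : ℝ≥0∞) = ∫⁻ _, 1 ∂labelLaw G := by simp
    _ ≤ ∫⁻ u, (ENNReal.ofReal (treeProb G β u (MST G u))
          + (B.indicator 1 u + ENNReal.ofReal η)) ∂labelLaw G := lintegral_mono_ae hpt
    _ = ∫⁻ u, ENNReal.ofReal (treeProb G β u (MST G u)) ∂labelLaw G
          + (labelLaw G B + ENNReal.ofReal η) := by
        rw [lintegral_add_right _ (by
          exact (measurable_one.indicator hBm).add measurable_const),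
          lintegral_add_right _ measurable_const, lintegral_indicator_one hBm]
        simp
    _ ≤ _ := by gcongr

end LargeBeta

/-! ### Small `β`: many competing trees -/

section SmallBeta

variable {V : Type*} [Fintype V] {G T : SimpleGraph V}

/-- Factors that each depend on their own coordinate may be integrated out one at a time. -/
lemma lintegral_prod_mul_le {ι : Type*} [Fintype ι] [DecidableEq ι] {X : ι → Type*}
    [∀ i, MeasurableSpace (X i)] (μ : ∀ i, Measure (X i)) [∀ i, SigmaFinite (μ i)]
    {g h : ι → (∀ i, X i) → ℝ≥0∞} (hg : ∀ i, Measurable (g i)) (hh : ∀ i, Measurable (h i))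
    {N : Finset ι} {q : ℝ≥0∞}
    (hgu : ∀ i ∈ N, ∀ j, j ≠ i → ∀ u x, g j (Function.update u i x) = g j u)
    (hhu : ∀ i ∈ N, ∀ j, j ≠ i → ∀ u x, h j (Function.update u i x) = h j u)
    (hq : ∀ i ∈ N, ∀ u, ∫⁻ x, g i (Function.update u i x) * h i (Function.update u i x) ∂μ i
      ≤ q * ∫⁻ x, g i (Function.update u i x) ∂μ i) :
    ∫⁻ u, ∏ i ∈ N, (g i u * h i u) ∂Measure.pi μ
      ≤ q ^ N.card * ∫⁻ u, ∏ i ∈ N, g i u ∂Measure.pi μ := by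
  -- The factors `h i` are attached one index at a time, each costing a factor `q`.
  suffices H : ∀ A ⊆ N, ∫⁻ u, ∏ i ∈ N, (if i ∈ A then g i u * h i u else g i u) ∂Measure.pi μ
      ≤ q ^ A.card * ∫⁻ u, ∏ i ∈ N, g i u ∂Measure.pi μ by
    refine le_trans (le_of_eq (lintegral_congr fun u => ?_)) (H N subset_rfl)
    exact Finset.prod_congr rfl fun i hi => by simp [hi]
  intro A
  induction A using Finset.induction_on with
  | empty => simp
  | insert a A ha ih =>
    intro hAN
    have haN : a ∈ N := hAN (Finset.mem_insert_self a A)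
    have hmeas : ∀ B : Finset ι,
        Measurable fun u => ∏ i ∈ N, (if i ∈ B then g i u * h i u else g i u) := by
      intro B
      refine Finset.measurable_fun_prod _ fun i _ => ?_
      split_ifs
      · exact (hg i).mul (hh i)
      · exact hg i
    have hR : ∀ u x, ∏ i ∈ N.erase a, (if i ∈ insert a A
          then g i (Function.update u a x) * h i (Function.update u a x)
          else g i (Function.update u a x))
        = ∏ i ∈ N.erase a, (if i ∈ A then g i u * h i u else g i u) := by
      intro u x
      refine Finset.prod_congr rfl fun i hi => ?_
      have hia := Finset.ne_of_mem_erase hi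
      rw [hgu a haN i hia, hhu a haN i hia]
      simp [hia]
    have hR' : ∀ u x, ∏ i ∈ N.erase a, (if i ∈ A
          then g i (Function.update u a x) * h i (Function.update u a x)
          else g i (Function.update u a x))
        = ∏ i ∈ N.erase a, (if i ∈ A then g i u * h i u else g i u) := by
      intro u x
      refine Finset.prod_congr rfl fun i hi => ?_
      have hia := Finset.ne_of_mem_erase hi
      rw [hgu a haN i hia, hhu a haN i hia]
    calc ∫⁻ u, ∏ i ∈ N, (if i ∈ insert a A then g i u * h i u else g i u) ∂Measure.pi μ
        ≤ ∫⁻ u, q * ∏ i ∈ N, (if i ∈ A then g i u * h i u else g i u) ∂Measure.pi μ := by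
          refine lintegral_le_of_lmarginal_le {a} (hmeas _) ((hmeas A).const_mul q) fun u => ?_
          rw [lmarginal_singleton, lmarginal_singleton]
          have hga : Measurable fun x => g a (Function.update u a x) :=
            (hg a).comp (measurable_update u)
          have hgh : Measurable fun x =>
              g a (Function.update u a x) * h a (Function.update u a x) :=
            hga.mul ((hh a).comp (measurable_update u))
          simp only [← Finset.mul_prod_erase N _ haN, hR, hR', Finset.mem_insert_self, if_true, ha,
            if_false]
          rw [lintegral_mul_const _ hgh, lintegral_const_mul _ (hga.mul_const _),
            lintegral_mul_const _ hga, ← mul_assoc]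
          gcongr
          exact hq a haN u
      _ = q * ∫⁻ u, ∏ i ∈ N, (if i ∈ A then g i u * h i u else g i u) ∂Measure.pi μ :=
          lintegral_const_mul _ (hmeas A)
      _ ≤ q * (q ^ A.card * ∫⁻ u, ∏ i ∈ N, g i u ∂Measure.pi μ) := by
          gcongr
          exact ih ((Finset.subset_insert a A).trans hAN)
      _ = _ := by rw [Finset.card_insert_of_notMem ha, pow_succ]; ring

/-- On the first fraction `1 / (1 + β)` of the interval from `a` to `1` one has `β * (x - a) ≤ 1`,
so the integrand is at most `exp (-exp (-1))`; elsewhere it is at most `1`. Taking a fraction of the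
interval makes the bound on the average independent of `a`. -/
lemma lintegral_exp_neg_exp_le {a β : ℝ} (ha : 0 ≤ a) (hβ : 0 ≤ β) :
    ∫⁻ x in Set.Icc (0 : ℝ) 1, (Set.Ioi a).indicator 1 x
        * ENNReal.ofReal (Real.exp (-Real.exp (-(β * (x - a)))))
      ≤ ENNReal.ofReal (1 - (1 - Real.exp (-Real.exp (-1))) / (1 + β))
        * ∫⁻ x in Set.Icc (0 : ℝ) 1, (Set.Ioi a).indicator 1 x := by
  have hset : Set.Ioi a ∩ Set.Icc (0 : ℝ) 1 = Set.Ioc a 1 := by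
    ext x; simp only [Set.mem_inter_iff, Set.mem_Ioi, Set.mem_Icc, Set.mem_Ioc]
    constructor
    · rintro ⟨h1, -, h2⟩; exact ⟨h1, h2⟩
    · rintro ⟨h1, h2⟩; exact ⟨h1, ha.trans h1.le, h2⟩
  have hL : ∀ F : ℝ → ℝ≥0∞, ∫⁻ x in Set.Icc (0 : ℝ) 1, (Set.Ioi a).indicator 1 x * F x
      = ∫⁻ x in Set.Ioc a 1, F x := by
    intro F
    have : (fun x => (Set.Ioi a).indicator 1 x * F x) = (Set.Ioi a).indicator F := by
      ext x; by_cases hx : x ∈ Set.Ioi a <;> simp [hx]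
    rw [this, lintegral_indicator measurableSet_Ioi, Measure.restrict_restrict measurableSet_Ioi,
      hset]
  have hL1 : ∫⁻ x in Set.Icc (0 : ℝ) 1, (Set.Ioi a).indicator 1 x = ENNReal.ofReal (1 - a) := by
    rw [lintegral_indicator_one measurableSet_Ioi, Measure.restrict_apply measurableSet_Ioi, hset,
      Real.volume_Ioc]
  rw [hL, hL1]
  rcases le_or_gt 1 a with h1 | h1
  · simp [Set.Ioc_eq_empty_of_le h1]
  set k := Real.exp (-Real.exp (-1)) with hk
  have hk0 : 0 < k := Real.exp_pos _
  have hk1 : k < 1 := by rw [hk, Real.exp_lt_one_iff]; simp [Real.exp_pos]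
  set d := (1 - a) / (1 + β) with hd
  have hd0 : 0 < d := by have : 0 < 1 - a := by linarith
                         positivity
  have hd1 : d ≤ 1 - a := div_le_self (by linarith) (by linarith)
  have hbd : β * d ≤ 1 := by
    rw [hd, ← mul_div_assoc, div_le_one (by linarith)]
    nlinarith
  rw [← Set.Ioc_union_Ioc_eq_Ioc (show a ≤ a + d by linarith) (show a + d ≤ 1 by linarith)]
  calc ∫⁻ x in Set.Ioc a (a + d) ∪ Set.Ioc (a + d) 1,
        ENNReal.ofReal (Real.exp (-Real.exp (-(β * (x - a)))))
      ≤ (∫⁻ x in Set.Ioc a (a + d), ENNReal.ofReal (Real.exp (-Real.exp (-(β * (x - a))))))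
        + ∫⁻ x in Set.Ioc (a + d) 1, ENNReal.ofReal (Real.exp (-Real.exp (-(β * (x - a))))) :=
        lintegral_union_le _ _ _
    _ ≤ (∫⁻ _ in Set.Ioc a (a + d), ENNReal.ofReal k)
        + ∫⁻ _ in Set.Ioc (a + d) 1, ENNReal.ofReal 1 := by
        gcongr ?_ + ?_
        · refine setLIntegral_mono measurable_const fun x hx => ENNReal.ofReal_le_ofReal ?_
          rw [hk, Real.exp_le_exp, neg_le_neg_iff, Real.exp_le_exp, neg_le_neg_iff]
          exact (mul_le_mul_of_nonneg_left (by linarith [hx.2]) hβ).trans hbd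
        · refine setLIntegral_mono measurable_const fun x hx => ENNReal.ofReal_le_ofReal ?_
          rw [Real.exp_le_one_iff, neg_nonpos]
          exact (Real.exp_pos _).le
    _ = ENNReal.ofReal (k * d + (1 - (a + d))) := by
        rw [setLIntegral_const, setLIntegral_const, Real.volume_Ioc, Real.volume_Ioc,
          ← ENNReal.ofReal_mul hk0.le, ← ENNReal.ofReal_mul zero_le_one,
          ← ENNReal.ofReal_add (by nlinarith) (by linarith)]
        congr 1
        ring
    _ = _ := by
        rw [← ENNReal.ofReal_mul' (by linarith)]
        congr 1
        rw [hd]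
        field_simp
        ring

open Classical in
/-- The edges of `G` outside `T`. -/
noncomputable def outerEdges (G T : SimpleGraph V) : Finset G.edgeSet := {e | e.1 ∉ T.edgeSet}

lemma mem_outerEdges {e : G.edgeSet} : e ∈ outerEdges G T ↔ e.1 ∉ T.edgeSet := by
  simp [outerEdges]

/-- The total relative weight of the trees obtained from `T` by the best exchange for each edge
outside `T`. -/
noncomputable def exchangeWeight (G T : SimpleGraph V) (β : ℝ) (u : G.edgeSet → ℝ) : ℝ :=
  ∑ e ∈ outerEdges G T, Real.exp (-(β * (u e - bottleneck G T e u)))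

/-- Exchanging each outside edge with its bottleneck edge gives pairwise distinct trees, as the
inserted edge is the only one not in `T`. These trees and `T` itself bound the partition function
from below. -/
lemma treeProb_le_inv (hT : T ∈ spanningTrees G) (β : ℝ) {u : G.edgeSet → ℝ}
    (hu : ∀ e, 0 < u e) : treeProb G β u T ≤ 1 / (1 + exchangeWeight G T β u) := by
  classical
  have hT' := mem_spanningTrees.1 hT
  have hex : ∀ e ∈ outerEdges G T, ∃ f ∈ replaceable G T e,
      (bottleneck G T e u : ℝ) = u f := fun e he =>
    exists_bottleneck_eq hT'.2 (mem_outerEdges.1 he) hT'.1 hu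
  choose! F hF1 hF2 using hex
  have hinj : Set.InjOn (fun e : G.edgeSet => swapEdge T (F e) e) (outerEdges G T) := by
    intro e he e' he' h
    have hmem : e.1 ∈ (swapEdge T (F e') e').edgeSet := by
      dsimp only at h
      rw [← h, edgeSet_swapEdge _ _ (G.not_isDiag_of_mem_edgeSet e.2)]
      exact Set.mem_insert _ _
    rw [edgeSet_swapEdge _ _ (G.not_isDiag_of_mem_edgeSet e'.2)] at hmem
    rcases hmem with h | h
    · exact Subtype.ext h
    · exact absurd h.1 (mem_outerEdges.1 he)
  have hsub : (outerEdges G T).image (fun e => swapEdge T (F e) e)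
      ⊆ (spanningTrees G).erase T := by
    intro T₁ h
    obtain ⟨e, he, rfl⟩ := Finset.mem_image.1 h
    refine Finset.mem_erase.2 ⟨fun h => mem_outerEdges.1 he ?_,
      swapEdge_mem_spanningTrees hT'.1 (mem_replaceable.1 (hF1 e he)).2⟩
    rw [← h, edgeSet_swapEdge _ _ (G.not_isDiag_of_mem_edgeSet e.2)]
    exact Set.mem_insert _ _
  have hZ : Real.exp (-β * totalLabel G u T) * (1 + exchangeWeight G T β u)
      ≤ partitionFunction G β u := by
    rw [mul_add, mul_one, partitionFunction, ← Finset.add_sum_erase _ _ hT]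
    gcongr
    refine le_trans (le_of_eq ?_)
      (Finset.sum_le_sum_of_subset_of_nonneg hsub fun _ _ _ => (Real.exp_pos _).le)
    rw [Finset.sum_image hinj, exchangeWeight, Finset.mul_sum]
    refine Finset.sum_congr rfl fun e he => ?_
    rw [totalLabel_swapEdge (mem_outerEdges.1 he) (mem_replaceable.1 (hF1 e he)).1, hF2 e he,
      ← Real.exp_add]
    congr 1
    ring
  have hS : 0 ≤ exchangeWeight G T β u := Finset.sum_nonneg fun _ _ => (Real.exp_pos _).le
  have hw := Real.exp_pos (-β * totalLabel G u T)
  rw [treeProb, div_le_div_iff₀ (lt_of_lt_of_le (by positivity) hZ) (by positivity), one_mul]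
  exact hZ

/-- The indicator of strict minimality and `exp (-S)` both factor over outside edges, and changing
one outside label affects only its own factor. Thus `lintegral_prod_mul_le` applies, with the
one-variable bound as `q`. -/
lemma lintegral_indicator_exp_neg_exchangeWeight_le (G T : SimpleGraph V) {β : ℝ} (hβ : 0 ≤ β) :
    ∫⁻ u, {u | IsStrictMin G T u}.indicator
        (fun u => ENNReal.ofReal (Real.exp (-exchangeWeight G T β u))) u ∂labelLaw G
      ≤ ENNReal.ofReal (1 - (1 - Real.exp (-Real.exp (-1))) / (1 + β)) ^ (outerEdges G T).card
        * labelLaw G {u | IsStrictMin G T u} := by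
  classical
  have hbm := measurable_bottleneck G T
  let g : G.edgeSet → (G.edgeSet → ℝ) → ℝ≥0∞ := fun e u =>
    (Set.Ioi (bottleneck G T e u : ℝ)).indicator 1 (u e)
  let h : G.edgeSet → (G.edgeSet → ℝ) → ℝ≥0∞ := fun e u =>
    ENNReal.ofReal (Real.exp (-Real.exp (-(β * (u e - bottleneck G T e u)))))
  have hgm : ∀ e, Measurable (g e) := by
    intro e
    have : g e = {u | (bottleneck G T e u : ℝ) < u e}.indicator 1 := by
      ext u; rfl
    rw [this]
    refine measurable_one.indicator (measurableSet_lt ?_ ?_) <;> fun_prop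
  have hhm : ∀ e, Measurable (h e) := by
    intro e
    fun_prop
  have hprod : ∀ u, ∏ e ∈ outerEdges G T, g e u = {u | IsStrictMin G T u}.indicator 1 u := by
    intro u
    by_cases hu : IsStrictMin G T u
    · rw [Set.indicator_of_mem (show u ∈ {u | IsStrictMin G T u} from hu)]
      refine Finset.prod_eq_one fun e he => ?_
      exact Set.indicator_of_mem (show u e ∈ Set.Ioi _ from hu e (mem_outerEdges.1 he)) _
    · rw [Set.indicator_of_notMem (show u ∉ {u | IsStrictMin G T u} from hu)]
      simp only [IsStrictMin, not_forall] at hu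
      obtain ⟨e, he, hlt⟩ := hu
      exact Finset.prod_eq_zero (mem_outerEdges.2 he)
        (Set.indicator_of_notMem (show u e ∉ Set.Ioi _ from hlt) _)
  have hprodh : ∀ u, ∏ e ∈ outerEdges G T, h e u
      = ENNReal.ofReal (Real.exp (-exchangeWeight G T β u)) := by
    intro u
    rw [← ENNReal.ofReal_prod_of_nonneg fun _ _ => (Real.exp_pos _).le, ← Real.exp_sum,
      Finset.sum_neg_distrib, exchangeWeight]
  have key := lintegral_prod_mul_le (fun _ : G.edgeSet => volume.restrict (Set.Icc (0 : ℝ) 1))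
    hgm hhm (N := outerEdges G T)
    (q := ENNReal.ofReal (1 - (1 - Real.exp (-Real.exp (-1))) / (1 + β)))
    (fun i hi j hj u x => by
      simp only [g, bottleneck_update u (mem_outerEdges.1 hi), Function.update_of_ne hj])
    (fun i hi j hj u x => by
      simp only [h, bottleneck_update u (mem_outerEdges.1 hi), Function.update_of_ne hj])
    (fun i hi u => by
      simp only [g, h, bottleneck_update u (mem_outerEdges.1 hi), Function.update_self]
      exact lintegral_exp_neg_exp_le (NNReal.coe_nonneg _) hβ)
  simp only [Finset.prod_mul_distrib, hprod, hprodh] at key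
  rw [lintegral_indicator_one (measurableSet_isStrictMin G T)] at key
  refine le_trans (le_of_eq (lintegral_congr fun u => ?_)) key
  by_cases hu : u ∈ {u | IsStrictMin G T u} <;> simp [hu]

/-- A pointwise Chernoff bound: the first term covers `A ≤ S`, the second `S ≤ A`. -/
lemma inv_one_add_le {A S : ℝ} (hA : 0 ≤ A) (hS : 0 ≤ S) :
    1 / (1 + S) ≤ 1 / (1 + A) + Real.exp A * Real.exp (-S) := by
  rcases le_total A S with h | h
  · exact (one_div_le_one_div_of_le (by linarith) (by linarith)).trans
      (le_add_of_nonneg_right (by positivity))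
  · have h1 : 1 / (1 + S) ≤ 1 := (div_le_one (by linarith)).2 (by linarith)
    have h2 : 1 ≤ Real.exp A * Real.exp (-S) := by
      rw [← Real.exp_add]
      exact Real.one_le_exp (by linarith)
    exact (h1.trans h2).trans (le_add_of_nonneg_left (by positivity))

lemma card_outerEdges (hT : T ∈ spanningTrees G) :
    (outerEdges G T).card + Nat.card V = Nat.card G.edgeSet + 1 := by
  classical
  obtain ⟨hTG, hT⟩ := mem_spanningTrees.1 hT
  have h1 := (Finset.univ : Finset G.edgeSet).card_filter_add_card_filter_not
    (fun e : G.edgeSet => e.1 ∈ T.edgeSet)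
  have h2 : (Finset.univ.filter fun e : G.edgeSet => e.1 ∈ T.edgeSet).card
      = Nat.card T.edgeSet := by
    rw [← Finset.card_map (Function.Embedding.subtype _), ← Set.ncard_coe_finset,
      Nat.card_coe_set_eq]
    congr 1
    ext e
    simpa using fun he => SimpleGraph.edgeSet_mono hTG he
  have h3 : (outerEdges G T).card
      = (Finset.univ.filter fun e : G.edgeSet => ¬ e.1 ∈ T.edgeSet).card := by
    unfold outerEdges
    congr!
  have h4 := (SimpleGraph.isTree_iff_connected_and_card.1 hT).2
  rw [Finset.card_univ, ← Nat.card_eq_fintype_card] at h1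
  omega

lemma sum_labelLaw_isStrictMin_le (G : SimpleGraph V) :
    ∑ T ∈ spanningTrees G, labelLaw G {u | IsStrictMin G T u} ≤ 1 := by
  rw [← measure_biUnion_finset]
  · exact prob_le_one
  · intro T hT T' hT' hne
    exact Set.disjoint_left.2 fun u h h' => hne (IsStrictMin.eq h h' hT hT')
  · exact fun T _ => measurableSet_isStrictMin G T

/-- The bound is summed over the possible values of the MST. The events of strict minimality are
disjoint, so the sum costs nothing. -/
lemma lintegral_treeProb_le (hG : G.Connected) {β A : ℝ} (hβ : 0 ≤ β) (hA : 0 ≤ A) :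
    ∫⁻ u, ENNReal.ofReal (treeProb G β u (MST G u)) ∂labelLaw G
      ≤ ENNReal.ofReal (1 / (1 + A)) + ENNReal.ofReal (Real.exp A)
        * ENNReal.ofReal (1 - (1 - Real.exp (-Real.exp (-1))) / (1 + β))
          ^ (Nat.card G.edgeSet + 1 - Nat.card V) := by
  set q := ENNReal.ofReal (1 - (1 - Real.exp (-Real.exp (-1))) / (1 + β))
  set m := Nat.card G.edgeSet + 1 - Nat.card V with hm
  have hmeas : ∀ T, Measurable ({u | IsStrictMin G T u}.indicator
      fun u => ENNReal.ofReal (Real.exp (-exchangeWeight G T β u))) := by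
    intro T
    refine Measurable.indicator ?_ (measurableSet_isStrictMin G T)
    have := measurable_bottleneck G T
    unfold exchangeWeight
    fun_prop
  have hpt : ∀ᵐ u ∂labelLaw G, ENNReal.ofReal (treeProb G β u (MST G u))
      ≤ ∑ T ∈ spanningTrees G,
        (ENNReal.ofReal (1 / (1 + A)) * {u | IsStrictMin G T u}.indicator 1 u
          + ENNReal.ofReal (Real.exp A) * {u | IsStrictMin G T u}.indicator
            (fun u => ENNReal.ofReal (Real.exp (-exchangeWeight G T β u))) u) := by
    filter_upwards [ae_labelLaw_isStrictMin_MST hG, ae_labelLaw_pos G] with u hu hpos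
    have hM := (MST_spec hG u).1
    have hS : 0 ≤ exchangeWeight G (MST G u) β u :=
      Finset.sum_nonneg fun _ _ => (Real.exp_pos _).le
    refine le_trans ?_ (Finset.single_le_sum (fun _ _ => zero_le) hM)
    have hmem : u ∈ {v | IsStrictMin G (MST G u) v} := hu
    rw [Set.indicator_of_mem hmem, Set.indicator_of_mem hmem, Pi.one_apply, mul_one,
      ← ENNReal.ofReal_mul (Real.exp_pos A).le,
      ← ENNReal.ofReal_add (by positivity) (by positivity)]
    exact ENNReal.ofReal_le_ofReal ((treeProb_le_inv hM β hpos).trans (inv_one_add_le hA hS))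
  refine (lintegral_mono_ae hpt).trans ?_
  rw [lintegral_finsetSum]
  · calc _ ≤ ∑ T ∈ spanningTrees G, (ENNReal.ofReal (1 / (1 + A))
            + ENNReal.ofReal (Real.exp A) * q ^ m) * labelLaw G {u | IsStrictMin G T u} := by
          refine Finset.sum_le_sum fun T hT => ?_
          rw [lintegral_add_right _ ((hmeas T).const_mul _),
            lintegral_const_mul _ (measurable_one.indicator (measurableSet_isStrictMin G T)),
            lintegral_const_mul _ (hmeas T),
            lintegral_indicator_one (measurableSet_isStrictMin G T), add_mul, mul_assoc _ (q ^ m)]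
          gcongr
          have hcard : (outerEdges G T).card = m := by
            have := card_outerEdges hT
            omega
          rw [← hcard]
          exact lintegral_indicator_exp_neg_exchangeWeight_le G T hβ
      _ ≤ _ := by
          rw [← Finset.mul_sum]
          exact mul_le_of_le_one_right zero_le (sum_labelLaw_isStrictMin_le G)
  · exact fun T _ => ((measurable_one.indicator (measurableSet_isStrictMin G T)).const_mul _).add
      ((hmeas T).const_mul _)

end SmallBeta

/-! ### Asymptotics on the complete graph -/

section CompleteGraph

lemma card_edgeSet_top (n : ℕ) :
    Nat.card (⊤ : SimpleGraph (Fin n)).edgeSet = n.choose 2 := by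
  classical
  rw [Nat.card_eq_fintype_card, ← SimpleGraph.edgeFinset_card,
    SimpleGraph.card_edgeFinset_top_eq_card_choose_two, Fintype.card_fin]

lemma connected_top_fin {n : ℕ} (hn : 1 ≤ n) : (⊤ : SimpleGraph (Fin n)).Connected := by
  have : Nonempty (Fin n) := ⟨⟨0, hn⟩⟩
  exact SimpleGraph.connected_top

lemma tendsto_coupling_eq_one {β : ℕ → ℝ} (hβ : ∀ n, 0 ≤ β n)
    (h : (fun n : ℕ => (n : ℝ) ^ 2 * Real.log n) =o[atTop] β) :
    Tendsto (fun n : ℕ => coupling (⊤ : SimpleGraph (Fin n)) (β n) {ω | ω.2 = MST ⊤ ω.1})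
      atTop (𝓝 1) := by
  rw [ENNReal.tendsto_nhds ENNReal.one_ne_top]
  intro ε' hε'
  obtain ⟨r, hr0, hr⟩ := ENNReal.lt_iff_exists_nnreal_btwn.1 hε'
  have hr0 : (0 : ℝ) < r := by exact_mod_cast hr0
  set ε : ℝ := r / 2 with hε
  have hε0 : 0 < ε := by positivity
  have hinv : ∀ᶠ n : ℕ in atTop, 1 / (n : ℝ) ≤ ε :=
    (tendsto_one_div_atTop_nhds_zero_nat (𝕜 := ℝ)).eventually (ge_mem_nhds hε0)
  -- The constant `ε / 5` gives `β n * δ ≥ 5 * log n` for `δ = ε / n^2`. The resulting `n^(-5)`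
  -- beats `|E|^2 ≤ n^4` and leaves `1 / n`.
  filter_upwards [h.bound (show 0 < ε / 5 by positivity), hinv, eventually_ge_atTop 1]
    with n hn hn' hn1
  have hG := connected_top_fin hn1
  have hprob := isProbabilityMeasure_coupling hG (β n)
  refine ⟨?_, prob_le_one.trans le_self_add⟩
  have hnpos : (0 : ℝ) < n := by exact_mod_cast hn1
  have hlog : 0 ≤ Real.log n := Real.log_nonneg (by exact_mod_cast hn1)
  rw [Real.norm_of_nonneg (by positivity), Real.norm_of_nonneg (hβ n)] at hn
  have key := one_le_lintegral_treeProb_add hG (hβ n) (ε / (n : ℝ) ^ 2)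
  rw [← coupling_apply_eq_MST hG] at key
  refine tsub_le_iff_right.2 (key.trans (add_le_add_right (le_trans ?_ hr.le) _))
  have hcard : (Nat.card (⊤ : SimpleGraph (Fin n)).edgeSet : ℝ) ≤ (n : ℝ) ^ 2 := by
    rw [card_edgeSet_top]
    exact_mod_cast Nat.choose_le_pow n 2
  have hexp : Real.exp (-(β n * (ε / (n : ℝ) ^ 2))) ≤ 1 / (n : ℝ) ^ 5 := by
    have h5 : 5 * Real.log n ≤ β n * (ε / (n : ℝ) ^ 2) := by
      rw [← mul_div_assoc, le_div_iff₀ (by positivity)]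
      linarith
    calc Real.exp (-(β n * (ε / (n : ℝ) ^ 2))) ≤ Real.exp (-(5 * Real.log n)) :=
          Real.exp_le_exp.2 (by linarith)
      _ = 1 / (n : ℝ) ^ 5 := by
          rw [Real.exp_neg, one_div, show 5 * Real.log n = Real.log ((n : ℝ) ^ 5) by
            rw [Real.log_pow]; norm_num, Real.exp_log (by positivity)]
  rw [← ENNReal.ofReal_natCast, ← ENNReal.ofReal_mul (by positivity),
    ← ENNReal.ofReal_add (by positivity) (by positivity), ← ENNReal.ofReal_coe_nnreal]
  refine ENNReal.ofReal_le_ofReal ?_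
  have e1 : (Nat.card (⊤ : SimpleGraph (Fin n)).edgeSet : ℝ) * (ε / (n : ℝ) ^ 2) ≤ ε := by
    calc _ ≤ (n : ℝ) ^ 2 * (ε / (n : ℝ) ^ 2) := by gcongr
      _ = ε := by field_simp
  have e2 : (Nat.card (⊤ : SimpleGraph (Fin n)).edgeSet : ℝ) ^ 2
      * Real.exp (-(β n * (ε / (n : ℝ) ^ 2))) ≤ ε := by
    calc _ ≤ ((n : ℝ) ^ 2) ^ 2 * (1 / (n : ℝ) ^ 5) := by gcongr
      _ = 1 / (n : ℝ) := by field_simp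
      _ ≤ ε := hn'
  linarith

lemma coupling_eq_MST_le {n : ℕ} (hn : 4 ≤ n) {β : ℝ} (hβ : 0 ≤ β) {c : ℝ}
    (hc : c = 1 - Real.exp (-Real.exp (-1))) :
    coupling (⊤ : SimpleGraph (Fin n)) β {ω | ω.2 = MST ⊤ ω.1}
      ≤ ENNReal.ofReal (1 / (1 + c / 16 * ((n : ℝ) ^ 2 / (1 + β)))
        + Real.exp (-(c / 16 * ((n : ℝ) ^ 2 / (1 + β))))) := by
  have hc0 : 0 < c := by
    rw [hc, sub_pos, Real.exp_lt_one_iff]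
    simp [Real.exp_pos]
  have hc1 : c < 1 := by
    rw [hc]
    linarith [Real.exp_pos (-Real.exp (-1))]
  set A := c / 16 * ((n : ℝ) ^ 2 / (1 + β)) with hA
  have hA0 : 0 ≤ A := by positivity
  have hG := connected_top_fin (show 1 ≤ n by omega)
  have key := lintegral_treeProb_le hG hβ hA0
  rw [← coupling_apply_eq_MST hG, ← hc, card_edgeSet_top, Nat.card_eq_fintype_card,
    Fintype.card_fin] at key
  set m := n.choose 2 + 1 - n with hm
  -- Here `m = (n - 1) * (n - 2) / 2`; the inequality fails at `n = 3`, whence `4 ≤ n`.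
  have hmn : (n : ℝ) ^ 2 / 8 ≤ m := by
    obtain ⟨k, rfl⟩ := Nat.exists_eq_add_of_le hn
    have h1 : (m : ℝ) = ((4 + k : ℕ).choose 2 : ℝ) + 1 - (4 + k : ℕ) := by
      rw [hm, Nat.cast_sub]
      · push_cast; ring
      · have : 4 + k ≤ (4 + k).choose 2 := by
          rw [Nat.choose_two_right, Nat.le_div_iff_mul_le (by norm_num)]
          exact Nat.mul_le_mul_left _ (by omega)
        omega
    rw [h1, Nat.cast_choose_two]
    push_cast
    nlinarith [(Nat.cast_nonneg k : (0 : ℝ) ≤ k)]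
  have hq0 : 0 ≤ 1 - c / (1 + β) := by
    rw [sub_nonneg, div_le_one (by linarith)]
    linarith
  -- The constant `16` in `A` is twice the `8` above, so that `exp A` absorbs only half of this
  -- decay.
  have hqm : (1 - c / (1 + β)) ^ m ≤ Real.exp (-(2 * A)) := by
    calc (1 - c / (1 + β)) ^ m ≤ Real.exp (-(c / (1 + β))) ^ m := by
          gcongr
          linarith [Real.add_one_le_exp (-(c / (1 + β)))]
      _ = Real.exp (m * -(c / (1 + β))) := (Real.exp_nat_mul _ _).symm
      _ ≤ _ := by
          rw [Real.exp_le_exp]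
          have : 2 * A = (n : ℝ) ^ 2 / 8 * (c / (1 + β)) := by
            rw [hA]
            ring
          rw [this, mul_neg, neg_le_neg_iff]
          gcongr
  refine key.trans ?_
  rw [← ENNReal.ofReal_pow hq0, ← ENNReal.ofReal_mul (Real.exp_pos A).le,
    ← ENNReal.ofReal_add (by positivity) (by positivity)]
  refine ENNReal.ofReal_le_ofReal (add_le_add_right ?_ _)
  calc Real.exp A * (1 - c / (1 + β)) ^ m ≤ Real.exp A * Real.exp (-(2 * A)) := by gcongr
    _ = Real.exp (-A) := by rw [← Real.exp_add]; congr 1; ring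

lemma tendsto_coupling_eq_zero {β : ℕ → ℝ} (hβ : ∀ n, 0 ≤ β n)
    (h : β =o[atTop] (fun n : ℕ => (n : ℝ) ^ 2)) :
    Tendsto (fun n : ℕ => coupling (⊤ : SimpleGraph (Fin n)) (β n) {ω | ω.2 = MST ⊤ ω.1})
      atTop (𝓝 0) := by
  obtain ⟨c, hc⟩ : ∃ c : ℝ, c = 1 - Real.exp (-Real.exp (-1)) := ⟨_, rfl⟩
  have hc0 : 0 < c := by
    rw [hc, sub_pos, Real.exp_lt_one_iff]
    simp [Real.exp_pos]
  have hdiv : Tendsto (fun n : ℕ => (1 + β n) / (n : ℝ) ^ 2) atTop (𝓝 0) := by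
    have h1 : Tendsto (fun n : ℕ => 1 / (n : ℝ) ^ 2) atTop (𝓝 0) := by
      have := (tendsto_one_div_atTop_nhds_zero_nat (𝕜 := ℝ)).pow 2
      simpa [div_pow] using this
    simpa [add_div] using h1.add h.tendsto_div_nhds_zero
  have hpos : ∀ᶠ n : ℕ in atTop, 0 < (1 + β n) / (n : ℝ) ^ 2 := by
    filter_upwards [eventually_ge_atTop 1] with n hn
    have := hβ n
    have : (0 : ℝ) < n := by exact_mod_cast hn
    positivity
  -- As `β n` may vanish, the ratio uses `1 + β n`, which is still negligible against `n^2`.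
  have htop : Tendsto (fun n : ℕ => c / 16 * ((n : ℝ) ^ 2 / (1 + β n))) atTop atTop := by
    have h2 := (tendsto_nhdsWithin_iff.2 ⟨hdiv, hpos⟩).inv_tendsto_nhdsGT_zero
    refine Tendsto.const_mul_atTop (by positivity) (h2.congr fun n => ?_)
    simp
  have hlim : Tendsto (fun x : ℝ => 1 / (1 + x) + Real.exp (-x)) atTop (𝓝 0) := by
    have h1 : Tendsto (fun x : ℝ => 1 / (1 + x)) atTop (𝓝 0) := by
      simp only [one_div]
      exact (tendsto_atTop_add_const_left atTop (1 : ℝ) tendsto_id).inv_tendsto_atTop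
    simpa using h1.add (Real.tendsto_exp_neg_atTop_nhds_zero)
  have hup := ENNReal.tendsto_ofReal (hlim.comp htop)
  rw [ENNReal.ofReal_zero] at hup
  refine tendsto_of_tendsto_of_tendsto_of_le_of_le' tendsto_const_nhds hup
    (Eventually.of_forall fun _ => zero_le) ?_
  filter_upwards [eventually_ge_atTop 4] with n hn
  exact coupling_eq_MST_le hn (hβ n) hc

lemma tendsto_coupling_ne_one {β : ℕ → ℝ} (hβ : ∀ n, 0 ≤ β n)
    (h : β =o[atTop] (fun n : ℕ => (n : ℝ) ^ 2)) :
    Tendsto (fun n : ℕ => coupling (⊤ : SimpleGraph (Fin n)) (β n) {ω | ω.2 ≠ MST ⊤ ω.1})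
      atTop (𝓝 1) := by
  have := ENNReal.Tendsto.sub (tendsto_const_nhds (x := (1 : ℝ≥0∞)))
    (tendsto_coupling_eq_zero hβ h) (Or.inl ENNReal.one_ne_top)
  rw [tsub_zero] at this
  refine this.congr' ?_
  -- For `n = 0` there is no spanning tree and the coupling has mass zero.
  filter_upwards [eventually_ge_atTop 1] with n hn
  have := isProbabilityMeasure_coupling (connected_top_fin hn) (β n)
  exact (prob_compl_eq_one_sub measurableSet_eq_MST).symm

end CompleteGraph

end RandomSpanningTree

theorem mainTheorem4 (β : ℕ → ℝ) (hβ : ∀ n, 0 ≤ β n) :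
    ((fun n : ℕ => (n : ℝ) ^ 2 * Real.log n) =o[atTop] β →
      Tendsto (fun n : ℕ =>
          RandomSpanningTree.coupling (⊤ : SimpleGraph (Fin n)) (β n)
            {ω | ω.2 = RandomSpanningTree.MST ⊤ ω.1})
        atTop (𝓝 1)) ∧
    (β =o[atTop] (fun n : ℕ => (n : ℝ) ^ 2) →
      Tendsto (fun n : ℕ =>
          RandomSpanningTree.coupling (⊤ : SimpleGraph (Fin n)) (β n)
            {ω | ω.2 ≠ RandomSpanningTree.MST ⊤ ω.1})
        atTop (𝓝 1)) :=
  ⟨RandomSpanningTree.tendsto_coupling_eq_one hβ, RandomSpanningTree.tendsto_coupling_ne_one hβ⟩
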